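/- Let $\mathcal M=\langle \{1,\dots,n\},\mathcal S,\mathcal X,\mathcal A,P,\Lambda,r,\gamma\rangle$ be a decentralized rich-observation MDP (Dec-ROMDP): $\mathcal S$, $\mathcal X$, $\mathcal A$ are finite sets of latent states, observations and individual actions ($\mathcal A\neq\emptyset$), $P(\cdot\mid s,\mathbf a)$ is the transition law under the joint action $\mathbf a\in\mathcal A^n$, $r(s,\mathbf a)$ is the shared reward, $0\le\gamma<1$, and in state $s$ the agents independently receive observations $x_i\sim\Lambda(\cdot\mid i,s)$, where for each $i$ the laws $\Lambda(\cdot\mid i,s)$, $s\in\mathcal S$, have disjoint supports, so that an observation determines the latent state. An individual observation $x$ of agent $i$ occurs if $\Lambda(x\mid i,s)>0$ for some $s$. A joint observation $\mathbf x$ occurs (in state $s$) if $\prod_i\Lambda(x_i\mid i,s)>0$. A joint policy is $\boldsymbol\pi=\langle\pi_1,\dots,\pi_n\rangle$ with $\pi_i:\mathcal X\to\mathcal A$. It is optimal if it maximizes $V^{\boldsymbol\pi}(\mathbf x)=\mathbb E[\sum_{t\ge0}\gamma^t r(s_t,\boldsymbol\pi(\mathbf x_t))\mid \mathbf x_0=\mathbf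 x]$ among all joint policies at every joint observation that occurs. For individual action-value functions $Q=[Q_i]_{i=1}^n$, $Q_i:\mathcal X\times\mathcal A\to\mathbb R$, put $Q_{\mathrm{tot}}(\mathbf x,\mathbf a)=\sum_i Q_i(x_i,a_i)$ and, with $s$ the state encoded by $\mathbf x$, $y_Q(\mathbf x,\mathbf a)=r(s,\mathbf a)+\gamma\,\mathbb E_{\mathbf x'}[\max_{\mathbf a'}Q_{\mathrm{tot}}(\mathbf x',\mathbf a')]$. For $\epsilon>0$ and an $\arg\max$ operator with any tie-breaking rule, let $$\tilde{\boldsymbol\pi}_Q(\mathbf a\mid\mathbf x)=\prod_{i=1}^n\Big(\tfrac{\epsilon}{|\mathcal A|}+(1-\epsilon)\,\mathbb I\big[a_i=\arg\max_{a'}Q_i(x_i,a')\big]\Big)$$ be the $\epsilon$-greedy policy of $Q$. Let $D_Q$ be a dataset of infinitely many samples collected with it, i.e. $p_{D_Q}(\mathbf x,\mathbf a)=\rho(s)\prod_i\Lambda(x_i\mid i,s)\,\tilde{\boldsymbol\pi}_Q(\mathbf a\mid\mathbf x)$, where the latent-state marginal $\rho$ may depend on the policy $\tilde{\boldsymbol\pi}_Q$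 in any way and gives positive probability to every latent state (whenever the policy gives positive probability to all actions). One iteration of on-policy FQI with linear value factorization (FQI-LVF) is $$\mathcal T_\epsilon^{\mathrm{LVF}}Q=\arg\min_{Q'}\ \sum_{\mathbf x,\mathbf a}p_{D_Q}(\mathbf x,\mathbf a)\big(y_Q(\mathbf x,\mathbf a)-Q'_{\mathrm{tot}}(\mathbf x,\mathbf a)\big)^2 .$$ **Theorem.** Assume that the optimal policy $\boldsymbol\pi^*$ is unique (policies being compared on the observations that occur). Then there is $\epsilon_0>0$, depending only on $\mathcal M$, such that for every $0<\epsilon<\epsilon_0$, every tie-breaking rule and every such $\rho$, on-policy FQI-LVF has a fixed-point value function that induces the optimal policy. That is, there is $Q=[Q_i]_{i=1}^n$ such that $Q$ is a minimizer in $\mathcal T_\epsilon^{\mathrm{LVF}}Q$, every minimizer $Q'$ in $\mathcal T_\epsilon^{\mathrm{LVF}}Q$ has $Q'_{\mathrm{tot}}(\mathbf x,\mathbf a)=Q_{\mathrm{tot}}(\mathbf x,\mathbf a)$ for all $\mathbf a$ and all joint observations $\mathbf x$ that occur, and for every agent $i$ and every observation $x$ that occurs for $i$, $\pi^*_i(x)$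 is the unique maximizer of $Q_i(x,\cdot)$. -/

import Mathlib

open scoped BigOperators

noncomputable section

/-- A decentralized rich-observation Markov decision process with agents `Fin n`, finite latent
state space `S`, observation space `X` and individual action space `A`. Given the latent state,
agent `i` receives an observation drawn from `emit i s`, independently of the other agents.
`emit_disjoint` is the rich-observation condition: every observation decodes the latent state. -/
structure DecROMDP (n : ℕ) (S X A : Type*) [Fintype S] [Fintype X] where
  /-- transition probabilities `P(s' | s, a)` -/
  P : S → (Fin n → A) → S → ℝ
  P_nonneg : ∀ s a s', 0 ≤ P s a s'
  P_sum : ∀ s a, ∑ s', P s a s' = 1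
  /-- emission probabilities `Λ(x | i, s)` -/
  emit : Fin n → S → X → ℝ
  emit_nonneg : ∀ i s x, 0 ≤ emit i s x
  emit_sum : ∀ i s, ∑ x, emit i s x = 1
  emit_disjoint : ∀ s₁ s₂, s₁ ≠ s₂ → ∀ i x, 0 < emit i s₁ x → emit i s₂ x = 0
  /-- global reward -/
  r : S → (Fin n → A) → ℝ
  /-- discount factor -/
  γ : ℝ
  γ_nonneg : 0 ≤ γ
  γ_lt_one : γ < 1

/-- Deterministic reactive decentralized joint policies `⟨π₁, …, πₙ⟩`, `πᵢ : X → A`. -/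
abbrev JointPolicy (n : ℕ) (X A : Type*) := Fin n → X → A

/-- Individual (randomized) policies `πᵢ(a | x)`; the joint policy is their product. -/
abbrev BehaviorPolicy (n : ℕ) (X A : Type*) := Fin n → X → A → ℝ

/-- Families `[Qᵢ]` of individual action-value functions. They parametrize the linearly
factorized class through `Qtot`. -/
abbrev IndivQ (n : ℕ) (X A : Type*) := Fin n → X → A → ℝ

/-- Linear value factorization `Q_tot(x, a) = ∑ᵢ Qᵢ(xᵢ, aᵢ)`. -/
def Qtot {n : ℕ} {X A : Type*} (Q : IndivQ n X A) (x : Fin n → X) (a : Fin n → A) : ℝ :=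
  ∑ i, Q i (x i) (a i)

/-- `V_tot(x) = max_a Q_tot(x, a)` (a maximum, as there are finitely many joint actions). -/
def Vtot {n : ℕ} {X A : Type*} (Q : IndivQ n X A) (x : Fin n → X) : ℝ :=
  ⨆ a : Fin n → A, Qtot Q x a

/-- A selector of maximizers, i.e. an `argmax` operator with some tie-breaking rule. -/
def IsArgmax {A : Type*} (argmax : (A → ℝ) → A) : Prop :=
  ∀ (f : A → ℝ) (a : A), f a ≤ f (argmax f)

/-- Decentralized `ε`-greedy policy:
`πᵢ(a | x) = ε / |A| + (1 - ε) 𝟙[a = argmax Qᵢ(x, ·)]`. -/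
def epsGreedy {n : ℕ} {X A : Type*} [Fintype A] [DecidableEq A] (argmax : (A → ℝ) → A)
    (ε : ℝ) (Q : IndivQ n X A) : BehaviorPolicy n X A :=
  fun i x a => ε / (Fintype.card A : ℝ) + (1 - ε) * (if a = argmax (Q i x) then 1 else 0)

/-- A decentralized policy that gives positive probability to every individual action. -/
def IsExploratory {n : ℕ} {X A : Type*} [Fintype A] (β : BehaviorPolicy n X A) : Prop :=
  (∀ i x a, 0 < β i x a) ∧ ∀ i x, ∑ a, β i x a = 1

/-- A data collection procedure, given by the latent-state marginal `ρ β` of the dataset obtained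
by running the policy `β`. It covers the state space if, for every exploratory `β`, this marginal
is a probability distribution that charges every latent state. -/
def CoversStates {n : ℕ} {S X A : Type*} [Fintype S] [Fintype A]
    (ρ : BehaviorPolicy n X A → S → ℝ) : Prop :=
  ∀ β, IsExploratory β → (∀ s, 0 < ρ β s) ∧ ∑ s, ρ β s = 1

namespace DecROMDP

variable {n : ℕ} {S X A : Type*} [Fintype S] [Fintype X]

/-- Probability of the joint observation `x` in latent state `s`. -/
def jointEmit (M : DecROMDP n S X A) (s : S) (x : Fin n → X) : ℝ :=
  ∏ i, M.emit i s (x i)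

/-- The joint action prescribed by a joint policy at a joint observation. -/
def act (π : JointPolicy n X A) (x : Fin n → X) : Fin n → A :=
  fun i => π i (x i)

/-- `E[r(s_t, π(x_t)) | s_0 = s, x_0 = x]` for the process driven by the policy `π`, computed by
conditioning on the first transition. -/
def expReward (M : DecROMDP n S X A) (π : JointPolicy n X A) : ℕ → S → (Fin n → X) → ℝ
  | 0, s, x => M.r s (act π x)
  | t + 1, s, x =>
      ∑ s', M.P s (act π x) s' * ∑ x', M.jointEmit s' x' * M.expReward π t s' x'

/-- `V^π(x) = E[∑ₜ γᵗ r(s_t, π(x_t)) | x_0 = x]`, where `s` is the latent state encoded by `x`. The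
series converges absolutely, the rewards being bounded and `0 ≤ γ < 1`. -/
def value (M : DecROMDP n S X A) (π : JointPolicy n X A) (s : S) (x : Fin n → X) : ℝ :=
  ∑' t : ℕ, M.γ ^ t * M.expReward π t s x

/-- The observation `x` of agent `i` occurs in some latent state. -/
def Observable (M : DecROMDP n S X A) (i : Fin n) (x : X) : Prop :=
  ∃ s, 0 < M.emit i s x

/-- A joint policy is optimal if it maximizes `V^π(x)` at every joint observation `x` that can
occur. -/
def IsOptimal (M : DecROMDP n S X A) (π : JointPolicy n X A) : Prop :=
  ∀ (π' : JointPolicy n X A) (s : S) (x : Fin n → X), 0 < M.jointEmit s x →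
    M.value π' s x ≤ M.value π s x

/-- `π` is the unique optimal policy; policies are compared on the observations that occur. -/
def IsUniqueOptimal (M : DecROMDP n S X A) (π : JointPolicy n X A) : Prop :=
  M.IsOptimal π ∧
    ∀ π' : JointPolicy n X A, M.IsOptimal π' → ∀ i x, M.Observable i x → π' i x = π i x

/-- Expected one-step TD target `y(x, a) = r(s, a) + γ E_{x'}[max_{a'} Q_tot(x', a')]`, where `s` is
the latent state encoded by `x`. -/
def target (M : DecROMDP n S X A) (Q : IndivQ n X A) (s : S) (a : Fin n → A) : ℝ :=
  M.r s a + M.γ * ∑ s', M.P s a s' * ∑ x', M.jointEmit s' x' * Vtot Q x'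

/-- Probability `p_D(x, a)`, jointly with the latent state `s` encoded by `x`, in a dataset with
latent-state marginal `d` and data collection policy `β`. -/
def dataProb (M : DecROMDP n S X A) (d : S → ℝ) (β : BehaviorPolicy n X A)
    (s : S) (x : Fin n → X) (a : Fin n → A) : ℝ :=
  d s * M.jointEmit s x * ∏ i, β i (x i) (a i)

/-- Regression loss of `Q'` against the targets computed from `Q`, under the data distribution. -/
def loss [Fintype A] (M : DecROMDP n S X A) (d : S → ℝ) (β : BehaviorPolicy n X A)
    (Q Q' : IndivQ n X A) : ℝ :=
  ∑ s, ∑ x, ∑ a, M.dataProb d β s x a * (M.target Q s a - Qtot Q' x a) ^ 2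

/-- The empirical Bellman operator `T_D^LVF`, as the set of all minimizers of the regression loss
(individual value functions are determined only up to terms that cancel in `Q_tot`). -/
def bellmanLVF [Fintype A] (M : DecROMDP n S X A) (d : S → ℝ) (β : BehaviorPolicy n X A)
    (Q : IndivQ n X A) : Set (IndivQ n X A) :=
  {Q' | ∀ Q'' : IndivQ n X A, M.loss d β Q Q' ≤ M.loss d β Q Q''}

/-- The on-policy Bellman operator `T_ε^LVF`: the dataset is collected by running the `ε`-greedy
policy of the current `Q`. -/
def onPolicyLVF [Fintype A] [DecidableEq A] (M : DecROMDP n S X A) (argmax : (A → ℝ) → A)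
    (ρ : BehaviorPolicy n X A → S → ℝ) (ε : ℝ) (Q : IndivQ n X A) : Set (IndivQ n X A) :=
  M.bellmanLVF (ρ (epsGreedy argmax ε Q)) (epsGreedy argmax ε Q) Q

/-- `Q` is a fixed point of the on-policy operator: `Q` is a result of applying the operator to `Q`,
and all results have the same joint value function `Q_tot` as `Q` where observations occur. -/
def IsFixedPointLVF [Fintype A] [DecidableEq A] (M : DecROMDP n S X A) (argmax : (A → ℝ) → A)
    (ρ : BehaviorPolicy n X A → S → ℝ) (ε : ℝ) (Q : IndivQ n X A) : Prop :=
  Q ∈ M.onPolicyLVF argmax ρ ε Q ∧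
    ∀ Q' ∈ M.onPolicyLVF argmax ρ ε Q, ∀ s x, 0 < M.jointEmit s x →
      ∀ a, Qtot Q' x a = Qtot Q x a

/-- The individual greedy policies of `Q` are well defined (the maximizers are unique) and equal to
`π` at every observation that occurs. -/
def Expresses (M : DecROMDP n S X A) (Q : IndivQ n X A) (π : JointPolicy n X A) : Prop :=
  ∀ i x, M.Observable i x → ∀ a, a ≠ π i x → Q i x a < Q i x (π i x)

end DecROMDP

end

/-! Observations decode the latent state, so a decentralized policy can play any joint action chosen
from the state. Uniqueness of the optimal policy thus means that the Bellman-optimal action `α s` is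
the only maximizer in every state, with a positive gap `Δ`.

If the data policy plays `α s` up to `ε`-noise, individual actions are independent given the
observations. Least-squares projection to additive functions is then explicit (`additiveProj`):
conditional averages in each coordinate minus a multiple of the mean. At `α s`, which carries mass
at least `1 - nε`, it changes a function by only `O(ε)` times its bound. Backing up, projecting and
evaluating at `α s` is therefore still a contraction for small `ε`, and its fixed point `W` is
`O(ε)`-close to the optimal value. The gap survives this perturbation, so the factors strictly
prefer `α s` (`exists_factored_fixedPoint`).

This closes the loop: the factors are greedy for `α`, so their `ε`-greedy policy is the assumed
noise around `α`, and their joint maximum is `W`. The residual is orthogonal to the additive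
functions at each occurring joint observation separately, so neither `ρ` nor the emission weights
influence the minimizer (`bellmanLVF_of_orthogonal`). -/

/-! ### Additive projection under product weights -/

section ProductAverage

variable {ι A : Type*} [Fintype ι] [DecidableEq ι] [Fintype A]

/-- Expectation of `y` when the coordinates are drawn independently with weights `b`. -/
def prodAvg (b : ι → A → ℝ) (y : (ι → A) → ℝ) : ℝ :=
  ∑ a, (∏ j, b j (a j)) * y a

/-- Expectation of `y` when coordinate `i` is set to `c` and the others are drawn independently. -/
def condAvg (b : ι → A → ℝ) (y : (ι → A) → ℝ) (i : ι) (c : A) : ℝ :=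
  prodAvg b fun a => y (Function.update a i c)

/-- The projection of `y` to additive functions under the product weights `b`. -/
def additiveProj (b : ι → A → ℝ) (y : (ι → A) → ℝ) (a : ι → A) : ℝ :=
  ∑ i, condAvg b y i (a i) - ((Fintype.card ι : ℝ) - 1) * prodAvg b y

lemma prodAvg_sub (b : ι → A → ℝ) (y z : (ι → A) → ℝ) :
    prodAvg b (fun a => y a - z a) = prodAvg b y - prodAvg b z := by
  simp [prodAvg, mul_sub, Finset.sum_sub_distrib]

lemma prodAvg_sum {κ : Type*} (s : Finset κ) (b : ι → A → ℝ) (y : κ → (ι → A) → ℝ) :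
    prodAvg b (fun a => ∑ k ∈ s, y k a) = ∑ k ∈ s, prodAvg b (y k) := by
  simp only [prodAvg, Finset.mul_sum]
  exact Finset.sum_comm

lemma prodAvg_mul_const (b : ι → A → ℝ) (y : (ι → A) → ℝ) (c : ℝ) :
    prodAvg b (fun a => y a * c) = prodAvg b y * c := by
  simp only [prodAvg, Finset.sum_mul, mul_assoc]

lemma prodAvg_const_mul (b : ι → A → ℝ) (y : (ι → A) → ℝ) (c : ℝ) :
    prodAvg b (fun a => c * y a) = c * prodAvg b y := by
  simp only [mul_comm c, prodAvg_mul_const]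

lemma sum_prod_weights {b : ι → A → ℝ} (hb : ∀ j, ∑ c, b j c = 1) :
    ∑ a : ι → A, ∏ j, b j (a j) = 1 := by
  classical
  rw [← Fintype.prod_sum]
  simp [hb]

lemma prodAvg_const {b : ι → A → ℝ} (hb : ∀ j, ∑ c, b j c = 1) (c : ℝ) :
    prodAvg b (fun _ => c) = c := by
  rw [prodAvg, ← Finset.sum_mul, sum_prod_weights hb, one_mul]

lemma additiveProj_sub (b : ι → A → ℝ) (y z : (ι → A) → ℝ) (a : ι → A) :
    additiveProj b (fun a => y a - z a) a = additiveProj b y a - additiveProj b z a := by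
  simp only [additiveProj, condAvg, prodAvg_sub, Finset.sum_sub_distrib]
  ring

/-- Two independent copies may exchange their `i`-th coordinates. -/
lemma prodAvg_prodAvg_exchange (b : ι → A → ℝ) (i : ι) (F : (ι → A) → (ι → A) → ℝ) :
    prodAvg b (fun a => prodAvg b fun a' => F a a') =
      prodAvg b (fun a => prodAvg b fun a' =>
        F (Function.update a i (a' i)) (Function.update a' i (a i))) := by
  let σ : (ι → A) × (ι → A) → (ι → A) × (ι → A) := fun p =>
    (Function.update p.1 i (p.2 i), Function.update p.2 i (p.1 i))
  have hσ : Function.Involutive σ := fun p => by simp [σ]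
  have hw : ∀ p, (∏ j, b j ((σ p).1 j)) * (∏ j, b j ((σ p).2 j)) =
      (∏ j, b j (p.1 j)) * ∏ j, b j (p.2 j) := by
    intro p
    rw [← Finset.prod_mul_distrib, ← Finset.prod_mul_distrib]
    refine Finset.prod_congr rfl fun j _ => ?_
    by_cases h : j = i
    · subst h; simp [σ, mul_comm]
    · simp [σ, h]
  simp only [prodAvg, Finset.mul_sum]
  rw [← Fintype.sum_prod_type', ← Fintype.sum_prod_type', ← Equiv.sum_comp hσ.toPerm]
  refine Finset.sum_congr rfl fun p _ => ?_
  rw [← mul_assoc, ← mul_assoc, ← hw p]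
  rfl

/-- Tower property. Average over two copies a function of the second copy only; after the exchange
its `i`-th coordinate comes from the first copy, and the inner average is `condAvg`. -/
lemma prodAvg_mul_condAvg {b : ι → A → ℝ} (hb : ∀ j, ∑ c, b j c = 1) (i : ι) (g : A → ℝ)
    (y : (ι → A) → ℝ) :
    prodAvg b (fun a => g (a i) * condAvg b y i (a i)) = prodAvg b fun a => g (a i) * y a := by
  have h := prodAvg_prodAvg_exchange b i (fun _ a' => g (a' i) * y a')
  rw [prodAvg_const hb] at h
  rw [h]
  simp only [condAvg, ← prodAvg_const_mul, Function.update_self]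

lemma prodAvg_condAvg {b : ι → A → ℝ} (hb : ∀ j, ∑ c, b j c = 1) (i : ι) (y : (ι → A) → ℝ) :
    prodAvg b (fun a => condAvg b y i (a i)) = prodAvg b y := by
  simpa using prodAvg_mul_condAvg hb i (fun _ => 1) y

lemma prodAvg_mul_of_ne {b : ι → A → ℝ} (hb : ∀ j, ∑ c, b j c = 1) {i j : ι} (hij : i ≠ j)
    (g f : A → ℝ) :
    prodAvg b (fun a => g (a i) * f (a j)) =
      prodAvg b (fun a => g (a i)) * prodAvg b fun a => f (a j) := by
  have h := prodAvg_prodAvg_exchange b j (fun a _ => g (a i) * f (a j))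
  simp only [prodAvg_const hb, Function.update_self, Function.update_of_ne hij] at h
  simp only [h, prodAvg_const_mul, prodAvg_mul_const]

/-- The residual of the additive projection is orthogonal to functions of one coordinate. -/
lemma prodAvg_mul_residual {b : ι → A → ℝ} (hb : ∀ j, ∑ c, b j c = 1) (i : ι) (g : A → ℝ)
    (y : (ι → A) → ℝ) :
    prodAvg b (fun a => g (a i) * (y a - additiveProj b y a)) = 0 := by
  -- The `card ι - 1` copies of the mean are handed out to the coordinates `j ≠ i`. The term of
  -- coordinate `i` cancels by the tower property; each other term is a covariance of independent
  -- coordinates.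
  have key : ∀ a, g (a i) * (y a - additiveProj b y a) =
      (g (a i) * y a - g (a i) * condAvg b y i (a i)) -
        ∑ j ∈ Finset.univ.erase i, (g (a i) * condAvg b y j (a j) - g (a i) * prodAvg b y) := by
    intro a
    rw [additiveProj, ← Finset.add_sum_erase _ _ (Finset.mem_univ i), Finset.sum_sub_distrib,
      Finset.sum_const, Finset.card_erase_of_mem (Finset.mem_univ i), Finset.card_univ,
      ← Finset.mul_sum, nsmul_eq_mul, Nat.cast_pred (Fintype.card_pos_iff.mpr ⟨i⟩)]
    ring
  simp only [key]
  rw [prodAvg_sub, prodAvg_sub, prodAvg_mul_condAvg hb, sub_self, prodAvg_sum, zero_sub,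
    neg_eq_zero]
  refine Finset.sum_eq_zero fun j hj => ?_
  rw [prodAvg_sub, prodAvg_mul_of_ne hb (Finset.ne_of_mem_erase hj).symm g, prodAvg_condAvg hb,
    prodAvg_mul_const, sub_self]

/-! ### Concentration at a point of large mass -/

lemma abs_prodAvg_le {b : ι → A → ℝ} (hb0 : ∀ j c, 0 ≤ b j c) (hb : ∀ j, ∑ c, b j c = 1)
    {y : (ι → A) → ℝ} {B : ℝ} (hy : ∀ a, |y a| ≤ B) : |prodAvg b y| ≤ B := by
  calc |prodAvg b y| ≤ ∑ a, |(∏ j, b j (a j)) * y a| := Finset.abs_sum_le_sum_abs _ _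
    _ ≤ ∑ a : ι → A, (∏ j, b j (a j)) * B := by
        refine Finset.sum_le_sum fun a _ => ?_
        have hw : 0 ≤ ∏ j, b j (a j) := Finset.prod_nonneg fun j _ => hb0 j _
        rw [abs_mul, abs_of_nonneg hw]
        exact mul_le_mul_of_nonneg_left (hy a) hw
    _ = B := prodAvg_const hb B

/-- An average is close to the value at a point that carries most of the mass. -/
lemma abs_prodAvg_sub_le {b : ι → A → ℝ} (hb0 : ∀ j c, 0 ≤ b j c) (hb : ∀ j, ∑ c, b j c = 1)
    {y : (ι → A) → ℝ} {B η : ℝ} (hy : ∀ a, |y a| ≤ B) {p : ι → A}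
    (hp : 1 - η ≤ ∏ j, b j (p j)) : |prodAvg b y - y p| ≤ 2 * η * B := by
  classical
  have hB : 0 ≤ B := (abs_nonneg _).trans (hy p)
  have hw : ∀ a : ι → A, 0 ≤ ∏ j, b j (a j) := fun a => Finset.prod_nonneg fun j _ => hb0 j _
  have hs := sum_prod_weights hb
  rw [← Finset.add_sum_erase _ _ (Finset.mem_univ p)] at hs
  -- The point `p` contributes nothing; the remaining mass is at most `η`, and each difference at
  -- most `2 * B`.
  have h1 : prodAvg b y - y p =
      ∑ a ∈ Finset.univ.erase p, (∏ j, b j (a j)) * (y a - y p) := by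
    rw [← prodAvg_const hb (y p), ← prodAvg_sub, prodAvg,
      ← Finset.add_sum_erase _ _ (Finset.mem_univ p), prodAvg_const hb, sub_self, mul_zero,
      zero_add]
  rw [h1]
  calc |∑ a ∈ Finset.univ.erase p, (∏ j, b j (a j)) * (y a - y p)|
      ≤ ∑ a ∈ Finset.univ.erase p, |(∏ j, b j (a j)) * (y a - y p)| :=
        Finset.abs_sum_le_sum_abs _ _
    _ ≤ ∑ a ∈ Finset.univ.erase p, (∏ j, b j (a j)) * (2 * B) := by
        refine Finset.sum_le_sum fun a _ => ?_
        rw [abs_mul, abs_of_nonneg (hw a)]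
        refine mul_le_mul_of_nonneg_left ?_ (hw a)
        have := abs_sub (y a) (y p)
        linarith [hy a, hy p]
    _ ≤ η * (2 * B) := by
        rw [← Finset.sum_mul]
        exact mul_le_mul_of_nonneg_right (by linarith) (by linarith)
    _ = 2 * η * B := by ring

lemma abs_condAvg_sub_le {b : ι → A → ℝ} (hb0 : ∀ j c, 0 ≤ b j c) (hb : ∀ j, ∑ c, b j c = 1)
    {y : (ι → A) → ℝ} {B η : ℝ} (hy : ∀ a, |y a| ≤ B) {p : ι → A}
    (hp : 1 - η ≤ ∏ j, b j (p j)) (i : ι) (c : A) :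
    |condAvg b y i c - y (Function.update p i c)| ≤ 2 * η * B :=
  abs_prodAvg_sub_le (y := fun a => y (Function.update a i c)) hb0 hb (fun _ => hy _) hp

lemma abs_additiveProj_sub_le [Nonempty ι] {b : ι → A → ℝ} (hb0 : ∀ j c, 0 ≤ b j c)
    (hb : ∀ j, ∑ c, b j c = 1) {y : (ι → A) → ℝ} {B η : ℝ} (hy : ∀ a, |y a| ≤ B)
    {p : ι → A} (hp : 1 - η ≤ ∏ j, b j (p j)) :
    |additiveProj b y p - y p| ≤ 4 * (Fintype.card ι : ℝ) * η * B := by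
  have hB : 0 ≤ B := (abs_nonneg _).trans (hy p)
  have hn : (1 : ℝ) ≤ Fintype.card ι := by exact_mod_cast Fintype.card_pos (α := ι)
  -- The coefficients of the projection sum to `card ι - (card ι - 1) = 1`, so `y p` can be
  -- subtracted inside every average.
  have h1 : additiveProj b y p - y p = ∑ i, (condAvg b y i (p i) - y p) -
      ((Fintype.card ι : ℝ) - 1) * (prodAvg b y - y p) := by
    simp [additiveProj, Finset.sum_sub_distrib]
    ring
  have h2 : |∑ i, (condAvg b y i (p i) - y p)| ≤ Fintype.card ι * (2 * η * B) := by
    refine (Finset.abs_sum_le_sum_abs _ _).trans ?_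
    rw [← nsmul_eq_mul, ← Finset.card_univ]
    refine Finset.sum_le_card_nsmul _ _ _ fun i _ => ?_
    simpa using abs_condAvg_sub_le hb0 hb hy hp i (p i)
  have h3 : |((Fintype.card ι : ℝ) - 1) * (prodAvg b y - y p)| ≤
      Fintype.card ι * (2 * η * B) := by
    rw [abs_mul, abs_of_nonneg (by linarith)]
    exact mul_le_mul (by linarith) (abs_prodAvg_sub_le hb0 hb hy hp) (abs_nonneg _) (by linarith)
  rw [h1]
  linarith [abs_sub (∑ i, (condAvg b y i (p i) - y p))
    (((Fintype.card ι : ℝ) - 1) * (prodAvg b y - y p))]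

end ProductAverage

/-! ### Bellman equations and the unique greedy action -/

namespace DecROMDP

variable {n : ℕ} {S X A : Type*} [Fintype S] [Fintype X]

/-- One-step lookahead value of the joint action `a` in state `s` with continuation values `V`. -/
def backup (M : DecROMDP n S X A) (V : S → ℝ) (s : S) (a : Fin n → A) : ℝ :=
  M.r s a + M.γ * ∑ s', M.P s a s' * V s'

lemma abs_sum_P_mul_le (M : DecROMDP n S X A) {f : S → ℝ} {B : ℝ} (hf : ∀ s, |f s| ≤ B)
    (s : S) (a : Fin n → A) : |∑ s', M.P s a s' * f s'| ≤ B := by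
  calc |∑ s', M.P s a s' * f s'| ≤ ∑ s', |M.P s a s' * f s'| := Finset.abs_sum_le_sum_abs _ _
    _ ≤ ∑ s', M.P s a s' * B := by
        refine Finset.sum_le_sum fun s' _ => ?_
        rw [abs_mul, abs_of_nonneg (M.P_nonneg s a s')]
        exact mul_le_mul_of_nonneg_left (hf s') (M.P_nonneg s a s')
    _ = B := by rw [← Finset.sum_mul, M.P_sum, one_mul]

lemma backup_sub (M : DecROMDP n S X A) (V W : S → ℝ) (s : S) (a : Fin n → A) :
    M.backup V s a - M.backup W s a = M.γ * ∑ s', M.P s a s' * (V s' - W s') := by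
  simp only [backup, mul_sub, Finset.sum_sub_distrib]
  ring

lemma abs_backup_sub_le (M : DecROMDP n S X A) (V W : S → ℝ) (s : S) (a : Fin n → A) :
    |M.backup V s a - M.backup W s a| ≤ M.γ * dist V W := by
  rw [backup_sub, abs_mul, abs_of_nonneg M.γ_nonneg]
  refine mul_le_mul_of_nonneg_left (M.abs_sum_P_mul_le (fun s' => ?_) s a) M.γ_nonneg
  rw [← Real.dist_eq]
  exact dist_le_pi_dist V W s'

/-- The Bellman optimality equation has a solution. -/
lemma exists_optimalValue [Fintype A] [Nonempty A] (M : DecROMDP n S X A) :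
    ∃ V : S → ℝ, ∀ s, V s = ⨆ a, M.backup V s a := by
  have hle : ∀ (V W : S → ℝ) (s : S),
      (⨆ a, M.backup V s a) ≤ (⨆ a, M.backup W s a) + M.γ * dist V W := by
    intro V W s
    refine ciSup_le fun a => ?_
    have h1 := le_ciSup (Finite.bddAbove_range fun a => M.backup W s a) a
    have h2 := (abs_le.mp (M.abs_backup_sub_le V W s a)).2
    linarith
  have hc : ContractingWith ⟨M.γ, M.γ_nonneg⟩ fun (V : S → ℝ) s => ⨆ a, M.backup V s a := by
    refine ⟨by exact_mod_cast M.γ_lt_one, LipschitzWith.of_dist_le_mul fun V W => ?_⟩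
    refine (dist_pi_le_iff (mul_nonneg M.γ_nonneg dist_nonneg)).mpr fun s => ?_
    rw [Real.dist_eq, abs_le]
    have h1 := hle V W s
    have h2 := hle W V s
    rw [dist_comm] at h2
    constructor <;> linarith
  exact ⟨hc.fixedPoint, fun s => (congrFun hc.fixedPoint_isFixedPt s).symm⟩

lemma jointEmit_nonneg (M : DecROMDP n S X A) (s : S) (x : Fin n → X) : 0 ≤ M.jointEmit s x :=
  Finset.prod_nonneg fun i _ => M.emit_nonneg i s _

lemma sum_jointEmit (M : DecROMDP n S X A) (s : S) : ∑ x, M.jointEmit s x = 1 := by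
  classical
  simp only [jointEmit]
  rw [← Fintype.prod_sum]
  simp [M.emit_sum]

lemma emit_pos_of_jointEmit_pos (M : DecROMDP n S X A) {s : S} {x : Fin n → X}
    (h : 0 < M.jointEmit s x) (i : Fin n) : 0 < M.emit i s (x i) := by
  refine lt_of_le_of_ne (M.emit_nonneg i s _) fun h0 => h.ne' ?_
  exact Finset.prod_eq_zero (Finset.mem_univ i) h0.symm

lemma exists_emit_pos (M : DecROMDP n S X A) (i : Fin n) (s : S) : ∃ x, 0 < M.emit i s x := by
  by_contra! h
  have := M.emit_sum i s
  rw [Finset.sum_eq_zero fun x _ => le_antisymm (h x) (M.emit_nonneg i s x)] at this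
  exact zero_ne_one this

lemma eq_of_emit_pos (M : DecROMDP n S X A) {i : Fin n} {s t : S} {x : X}
    (hs : 0 < M.emit i s x) (ht : 0 < M.emit i t x) : s = t := by
  by_contra h
  exact ht.ne' (M.emit_disjoint s t h i x hs)

lemma sum_jointEmit_mul_le (M : DecROMDP n S X A) {s : S} {f : (Fin n → X) → ℝ} {B : ℝ}
    (hf : ∀ x, 0 < M.jointEmit s x → f x ≤ B) : ∑ x, M.jointEmit s x * f x ≤ B := by
  calc ∑ x, M.jointEmit s x * f x ≤ ∑ x, M.jointEmit s x * B := by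
        refine Finset.sum_le_sum fun x _ => ?_
        rcases (M.jointEmit_nonneg s x).eq_or_lt with h | h
        · simp [← h]
        · exact mul_le_mul_of_nonneg_left (hf x h) h.le
    _ = B := by rw [← Finset.sum_mul, M.sum_jointEmit, one_mul]

lemma sum_jointEmit_mul_eq (M : DecROMDP n S X A) {s : S} {f : (Fin n → X) → ℝ} {B : ℝ}
    (hf : ∀ x, 0 < M.jointEmit s x → f x = B) : ∑ x, M.jointEmit s x * f x = B := by
  refine le_antisymm (M.sum_jointEmit_mul_le fun x hx => (hf x hx).le) ?_
  have := M.sum_jointEmit_mul_le (f := fun x => - f x) (B := -B) fun x hx => by rw [hf x hx]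
  simp only [mul_neg, Finset.sum_neg_distrib] at this
  linarith

lemma abs_expReward_le (M : DecROMDP n S X A) {R : ℝ} (hR : ∀ s a, |M.r s a| ≤ R)
    (π : JointPolicy n X A) (t : ℕ) (s : S) (x : Fin n → X) : |M.expReward π t s x| ≤ R := by
  induction t generalizing s x with
  | zero => exact hR _ _
  | succ t ih =>
    rw [expReward]
    refine M.abs_sum_P_mul_le (fun s' => abs_le.mpr ⟨?_, ?_⟩) s _
    · have := M.sum_jointEmit_mul_le (s := s') (f := fun x => - M.expReward π t s' x) (B := R)
        fun x _ => (neg_le_abs _).trans (ih s' x)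
      simp only [mul_neg, Finset.sum_neg_distrib] at this
      linarith
    · exact M.sum_jointEmit_mul_le fun x _ => (le_abs_self _).trans (ih s' x)

lemma summable_discounted_expReward [Finite A] (M : DecROMDP n S X A) (π : JointPolicy n X A)
    (s : S) (x : Fin n → X) : Summable fun t : ℕ => M.γ ^ t * M.expReward π t s x := by
  obtain ⟨R, hR⟩ := (Set.finite_range fun p : S × (Fin n → A) => |M.r p.1 p.2|).bddAbove
  have hR' : ∀ s a, |M.r s a| ≤ R := fun s a => hR ⟨(s, a), rfl⟩
  refine Summable.of_norm_bounded
    ((summable_geometric_of_lt_one M.γ_nonneg M.γ_lt_one).mul_right R) fun t => ?_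
  rw [Real.norm_eq_abs, abs_mul, abs_of_nonneg (pow_nonneg M.γ_nonneg t)]
  exact mul_le_mul_of_nonneg_left (M.abs_expReward_le hR' π t s x) (pow_nonneg M.γ_nonneg t)

/-- Bellman's equation for a joint policy. -/
lemma value_eq_backup [Finite A] (M : DecROMDP n S X A) (π : JointPolicy n X A)
    (s : S) (x : Fin n → X) :
    M.value π s x =
      M.backup (fun s' => ∑ x', M.jointEmit s' x' * M.value π s' x') s (act π x) := by
  have hs := M.summable_discounted_expReward π
  rw [value, (hs s x).tsum_eq_zero_add, backup]
  simp only [pow_zero, one_mul, expReward, value]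
  congr 1
  have h1 : ∀ s' x', HasSum (fun t : ℕ => M.γ ^ t * M.expReward π t s' x') (M.value π s' x') :=
    fun s' x' => (hs s' x').hasSum
  have h2 := ((hasSum_sum (s := Finset.univ) fun s' _ =>
    ((hasSum_sum (s := Finset.univ) fun x' _ =>
      (h1 s' x').mul_left (M.jointEmit s' x')).mul_left (M.P s (act π x) s'))).mul_left M.γ)
  simp only [value] at h2
  rw [← HasSum.tsum_eq h2]
  refine tsum_congr fun t => ?_
  simp only [Finset.mul_sum]
  refine Finset.sum_congr rfl fun s' _ => Finset.sum_congr rfl fun x' _ => ?_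
  ring

/-- A function on the occurring observations that is dominated by its own discounted expected
continuation is nonpositive. -/
lemma nonpos_of_le_discounted (M : DecROMDP n S X A) (α : S → (Fin n → X) → (Fin n → A))
    (D : S → (Fin n → X) → ℝ)
    (hD : ∀ s x, 0 < M.jointEmit s x →
      D s x ≤ M.γ * ∑ s', M.P s (α s x) s' * ∑ x', M.jointEmit s' x' * D s' x')
    (s : S) (x : Fin n → X) (hx : 0 < M.jointEmit s x) : D s x ≤ 0 := by
  classical
  -- At a maximizer over the finitely many occurring pairs, the hypothesis gives `D ≤ γ D`, hence `D
  -- ≤ 0`.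
  obtain ⟨⟨s₀, x₀⟩, h₀, hmax⟩ := Finset.exists_max_image
    (Finset.univ.filter fun p : S × (Fin n → X) => 0 < M.jointEmit p.1 p.2)
    (fun p => D p.1 p.2) ⟨(s, x), by simpa using hx⟩
  simp only [Finset.mem_filter, Finset.mem_univ, true_and, Prod.forall] at h₀ hmax
  have h1 : ∑ s', M.P s₀ (α s₀ x₀) s' * ∑ x', M.jointEmit s' x' * D s' x' ≤ D s₀ x₀ := by
    calc _ ≤ ∑ s', M.P s₀ (α s₀ x₀) s' * D s₀ x₀ :=
          Finset.sum_le_sum fun s' _ => mul_le_mul_of_nonneg_left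
            (M.sum_jointEmit_mul_le fun x' hx' => hmax s' x' hx') (M.P_nonneg _ _ _)
      _ = D s₀ x₀ := by rw [← Finset.sum_mul, M.P_sum, one_mul]
  have h2 := (hD s₀ x₀ h₀).trans (mul_le_mul_of_nonneg_left h1 M.γ_nonneg)
  have h3 : D s₀ x₀ ≤ 0 := by nlinarith [M.γ_lt_one]
  exact (hmax s x hx).trans h3

lemma sum_jointEmit_mul_sub (M : DecROMDP n S X A) (s : S) (f : (Fin n → X) → ℝ) (c : ℝ) :
    ∑ x, M.jointEmit s x * (f x - c) = ∑ x, M.jointEmit s x * f x - c := by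
  simp only [mul_sub, Finset.sum_sub_distrib]
  rw [← Finset.sum_mul, M.sum_jointEmit, one_mul]

lemma sum_jointEmit_mul_sub' (M : DecROMDP n S X A) (s : S) (f : (Fin n → X) → ℝ) (c : ℝ) :
    ∑ x, M.jointEmit s x * (c - f x) = c - ∑ x, M.jointEmit s x * f x := by
  simp only [mul_sub, Finset.sum_sub_distrib]
  rw [← Finset.sum_mul, M.sum_jointEmit, one_mul]

/-- By Bellman's equation for `π`, the excess of its value over `V` is dominated by its own
discounted continuation. The next lemma is the mirror image. -/
lemma value_le_of_backup_le [Finite A] (M : DecROMDP n S X A) {V : S → ℝ}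
    (hV : ∀ s a, M.backup V s a ≤ V s) (π : JointPolicy n X A) (s : S) (x : Fin n → X)
    (hx : 0 < M.jointEmit s x) : M.value π s x ≤ V s := by
  have := M.nonpos_of_le_discounted (fun _ x => act π x) (fun s x => M.value π s x - V s)
    (fun s x _ => ?_) s x hx
  · linarith
  · simp only [sum_jointEmit_mul_sub]
    rw [← backup_sub, ← value_eq_backup]
    linarith [hV s (act π x)]

lemma le_value_of_le_backup [Finite A] (M : DecROMDP n S X A) {V : S → ℝ} {π : JointPolicy n X A}
    (hV : ∀ s x, 0 < M.jointEmit s x → V s ≤ M.backup V s (act π x)) (s : S) (x : Fin n → X)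
    (hx : 0 < M.jointEmit s x) : V s ≤ M.value π s x := by
  have := M.nonpos_of_le_discounted (fun _ x => act π x) (fun s x => V s - M.value π s x)
    (fun s x hx => ?_) s x hx
  · linarith
  · simp only [sum_jointEmit_mul_sub']
    rw [← backup_sub, ← value_eq_backup]
    linarith [hV s x hx]

/-- Agents decode the latent state from their observations, so any choice of joint actions
depending on the state is carried out by a decentralized policy. -/
lemma exists_policy_of_state [Nonempty A] (M : DecROMDP n S X A) (α : S → Fin n → A) :
    ∃ π : JointPolicy n X A, ∀ i s x, 0 < M.emit i s x → π i x = α s i := by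
  classical
  refine ⟨fun i x => if h : M.Observable i x then α h.choose i else Classical.arbitrary A,
    fun i s x hx => ?_⟩
  have h : M.Observable i x := ⟨s, hx⟩
  simp only [dif_pos h, M.eq_of_emit_pos h.choose_spec hx]

/-- If the optimal policy is unique, it plays the only maximizer of the optimal action-value
function. -/
lemma IsUniqueOptimal.exists_greedy [Fintype A] [Nonempty A] {M : DecROMDP n S X A}
    {πstar : JointPolicy n X A} (hπ : M.IsUniqueOptimal πstar) :
    ∃ (V : S → ℝ) (α : S → Fin n → A), (∀ s, M.backup V s (α s) = V s) ∧
      (∀ s a, a ≠ α s → M.backup V s a < V s) ∧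
      ∀ i s x, 0 < M.emit i s x → πstar i x = α s i := by
  classical
  obtain ⟨V, hV⟩ := M.exists_optimalValue
  have hle : ∀ s a, M.backup V s a ≤ V s := fun s a => by
    rw [hV s]
    exact le_ciSup (Finite.bddAbove_range fun a => M.backup V s a) a
  have hmax : ∀ s, ∃ a, M.backup V s a = V s := fun s => by
    rw [hV s]
    exact exists_eq_ciSup_of_finite
  -- A decentralized policy carrying out maximizers attains the upper bound `V`, so it is optimal
  -- and must agree with `πstar`.
  have greedy : ∀ α : S → Fin n → A, (∀ s, M.backup V s (α s) = V s) →
      ∀ i s x, 0 < M.emit i s x → πstar i x = α s i := by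
    intro α hα i s x hx
    obtain ⟨π, hπα⟩ := M.exists_policy_of_state α
    rw [← hπα i s x hx]
    refine (hπ.2 π (fun π' s x hx => ?_) i x ⟨s, hx⟩).symm
    refine (M.value_le_of_backup_le hle π' s x hx).trans
      (M.le_value_of_le_backup (fun s x hx => ?_) s x hx)
    have : act π x = α s := funext fun i => hπα i s _ (M.emit_pos_of_jointEmit_pos hx i)
    rw [this, hα]
  choose α hα using hmax
  refine ⟨V, α, hα, fun s a ha => lt_of_le_of_ne (hle s a) fun h => ha ?_, greedy α hα⟩
  -- A second maximizer `a` at `s` would give another greedy choice. Both agree with `πstar` on the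
  -- observations of `s`, and every agent has one.
  have hα' : ∀ t, M.backup V t (Function.update α s a t) = V t := by
    intro t
    by_cases ht : t = s
    · subst ht; simpa using h
    · simpa [ht] using hα t
  funext i
  obtain ⟨x, hx⟩ := M.exists_emit_pos i s
  have h1 := greedy _ hα' i s x hx
  rw [Function.update_self] at h1
  rw [← h1, greedy α hα i s x hx]

end DecROMDP

/-! ### Weights of the exploring policy -/

/-- Distribution of individual actions that follow `p` up to `ε`-uniform exploration. -/
noncomputable def noisyWeights {ι A : Type*} [Fintype A] [DecidableEq A] (ε : ℝ) (p : ι → A)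
    (j : ι) (c : A) : ℝ :=
  ε / (Fintype.card A : ℝ) + (1 - ε) * (if c = p j then 1 else 0)

section NoisyWeights

variable {ι A : Type*} [Fintype A] [Nonempty A] [DecidableEq A] {ε : ℝ}

lemma noisyWeights_pos (h0 : 0 < ε) (h1 : ε ≤ 1) (p : ι → A) (j : ι) (c : A) :
    0 < noisyWeights ε p j c := by
  have : (0 : ℝ) < Fintype.card A := by exact_mod_cast Fintype.card_pos (α := A)
  have h2 : 0 ≤ (1 - ε) * (if c = p j then (1 : ℝ) else 0) :=
    mul_nonneg (by linarith) (by split_ifs <;> norm_num)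
  have := div_pos h0 this
  unfold noisyWeights
  linarith

lemma sum_noisyWeights (p : ι → A) (j : ι) : ∑ c, noisyWeights ε p j c = 1 := by
  have : (Fintype.card A : ℝ) ≠ 0 := by exact_mod_cast Fintype.card_ne_zero (α := A)
  simp only [noisyWeights, Finset.sum_add_distrib, ← Finset.mul_sum, Finset.sum_ite_eq',
    Finset.mem_univ, if_true, Finset.sum_const, Finset.card_univ, nsmul_eq_mul]
  field_simp
  ring

/-- Each factor is at least `1 - ε`; Bernoulli's inequality does the rest. -/
lemma one_sub_card_mul_le_prod_noisyWeights [Fintype ι] (h0 : 0 < ε) (h1 : ε ≤ 1) (p : ι → A) :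
    1 - (Fintype.card ι : ℝ) * ε ≤ ∏ j, noisyWeights ε p j (p j) := by
  have hb : 1 + (Fintype.card ι : ℝ) * (-ε) ≤ (1 + -ε) ^ Fintype.card ι :=
    one_add_mul_le_pow (by linarith) _
  calc 1 - (Fintype.card ι : ℝ) * ε ≤ (1 + -ε) ^ Fintype.card ι := by linarith
    _ = ∏ _j : ι, (1 + -ε) := by simp
    _ ≤ _ := by
      refine Finset.prod_le_prod (fun _ _ => by linarith) fun j _ => ?_
      have : 0 ≤ ε / (Fintype.card A : ℝ) := by positivity
      simp only [noisyWeights, if_true]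
      linarith

end NoisyWeights

/-! ### Fixed point of the factored backup -/

namespace DecROMDP

variable {n : ℕ} {S X A : Type*} [Fintype S] [Fintype X]

/-- For little exploration, the factored backup along the optimal actions has a fixed point whose
factors prefer the optimal actions. -/
lemma exists_factored_fixedPoint [Fintype A] [Nonempty A] [DecidableEq A] [NeZero n]
    (M : DecROMDP n S X A) {V : S → ℝ} {α : S → Fin n → A}
    (hα : ∀ s, M.backup V s (α s) = V s) (hgap : ∀ s a, a ≠ α s → M.backup V s a < V s) :
    ∃ ε₀ : ℝ, 0 < ε₀ ∧ ε₀ ≤ 1 ∧ ∀ ε, 0 < ε → ε < ε₀ → ∃ W : S → ℝ,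
      (∀ s, additiveProj (noisyWeights ε (α s)) (M.backup W s) (α s) = W s) ∧
      ∀ s i c, c ≠ α s i → condAvg (noisyWeights ε (α s)) (M.backup W s) i c <
        condAvg (noisyWeights ε (α s)) (M.backup W s) i (α s i) := by
  obtain ⟨B, hB0, hB⟩ : ∃ B : ℝ, 0 ≤ B ∧ ∀ s a, |M.backup V s a| ≤ B := by
    obtain ⟨B, hB⟩ :=
      (Set.finite_range fun p : S × (Fin n → A) => |M.backup V p.1 p.2|).bddAbove
    exact ⟨max B 0, le_max_right _ _, fun s a => le_max_of_le_left (hB ⟨(s, a), rfl⟩)⟩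
  obtain ⟨Δ, hΔ0, hΔ⟩ : ∃ Δ : ℝ, 0 < Δ ∧ ∀ s a, a ≠ α s → M.backup V s a + Δ ≤ V s := by
    have hf := Set.toFinite {p : S × (Fin n → A) | p.2 ≠ α p.1}
    obtain ⟨Δ, h0, hΔ⟩ : ∃ Δ : ℝ, 0 < Δ ∧ ∀ p ∈ {p : S × (Fin n → A) | p.2 ≠ α p.1},
        Δ ≤ V p.1 - M.backup V p.1 p.2 := by
      rcases Set.eq_empty_or_nonempty {p : S × (Fin n → A) | p.2 ≠ α p.1} with he | hne
      · exact ⟨1, one_pos, fun p hp => by simp [he] at hp⟩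
      · obtain ⟨q, hq, hmin⟩ := Set.exists_min_image _
          (fun p : S × (Fin n → A) => V p.1 - M.backup V p.1 p.2) hf hne
        exact ⟨_, sub_pos.mpr (hgap q.1 q.2 hq), hmin⟩
    exact ⟨Δ, h0, fun s a ha => by linarith [hΔ (s, a) ha]⟩
  have hγ : 0 < 1 - M.γ := sub_pos.mpr M.γ_lt_one
  have hn : (1 : ℝ) ≤ n := by exact_mod_cast NeZero.one_le
  have hC : 0 < 16 * (n : ℝ) ^ 2 * B / (1 - M.γ) + 4 * n * B + 1 := by positivity
  -- The second bound makes the projection error `4 n² ε` less than `(1 - γ) / 2`, for the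
  -- contraction. The third keeps the total perturbation of two compared action values below `Δ`;
  -- its `+ 1` keeps the denominator positive when `B = 0`.
  refine ⟨min 1 (min ((1 - M.γ) / (8 * (n : ℝ) ^ 2))
    (Δ / (16 * (n : ℝ) ^ 2 * B / (1 - M.γ) + 4 * n * B + 1))), by positivity,
    min_le_left _ _, fun ε h0 hε => ?_⟩
  rw [lt_min_iff, lt_min_iff, lt_div_iff₀ (by positivity), lt_div_iff₀ hC] at hε
  obtain ⟨h1, h2, h3⟩ := hε
  set b := fun s => noisyWeights ε (α s) with hb
  have hb0 : ∀ s j c, 0 ≤ b s j c := fun s j c => (noisyWeights_pos h0 h1.le _ j c).le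
  have hb1 : ∀ s j, ∑ c, b s j c = 1 := fun s j => sum_noisyWeights _ j
  have hbp : ∀ s, 1 - (n : ℝ) * ε ≤ ∏ j, b s j (α s j) := fun s => by
    simpa using one_sub_card_mul_le_prod_noisyWeights h0 h1.le (α s)
  have hproj : ∀ (s : S) (y : (Fin n → A) → ℝ) (C : ℝ), (∀ a, |y a| ≤ C) →
      |additiveProj (b s) y (α s) - y (α s)| ≤ 4 * n ^ 2 * ε * C := by
    intro s y C hy
    have := abs_additiveProj_sub_le (hb0 s) (hb1 s) hy (hbp s)
    rw [Fintype.card_fin] at this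
    linarith
  let F : (S → ℝ) → S → ℝ := fun W s => additiveProj (b s) (M.backup W s) (α s)
  have hK0 : 0 ≤ (1 + M.γ) / 2 := by linarith [M.γ_nonneg]
  -- The modulus is `γ + (1 - γ) / 2`: the backup contributes `γ`, the projection error the rest.
  -- Linearity of the projection reduces the claim to the difference of two backups.
  have hF : ContractingWith ⟨(1 + M.γ) / 2, hK0⟩ F := by
    refine ⟨?_, LipschitzWith.of_dist_le_mul fun W W' => ?_⟩
    · change (1 + M.γ) / 2 < 1
      linarith
    · change dist (F W) (F W') ≤ (1 + M.γ) / 2 * dist W W'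
      refine (dist_pi_le_iff (mul_nonneg hK0 dist_nonneg)).mpr fun s => ?_
      have h4 := M.abs_backup_sub_le W W' s
      have h5 := hproj s (fun a => M.backup W s a - M.backup W' s a) _ h4
      rw [additiveProj_sub] at h5
      rw [Real.dist_eq]
      have h6 := abs_sub_abs_le_abs_sub
        (additiveProj (b s) (M.backup W s) (α s) - additiveProj (b s) (M.backup W' s) (α s))
        (M.backup W s (α s) - M.backup W' s (α s))
      have h7 : 4 * (n : ℝ) ^ 2 * ε * (M.γ * dist W W') ≤ (1 - M.γ) / 2 * dist W W' := by
        rw [← mul_assoc]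
        refine mul_le_mul_of_nonneg_right ?_ dist_nonneg
        have : 4 * (n : ℝ) ^ 2 * ε * M.γ ≤ 4 * (n : ℝ) ^ 2 * ε * 1 :=
          mul_le_mul_of_nonneg_left M.γ_lt_one.le (by positivity)
        linarith
      have h8 := h4 (α s)
      change |additiveProj (b s) (M.backup W s) (α s) - additiveProj (b s) (M.backup W' s) (α s)|
        ≤ _
      linarith
  -- `F` moves `V` by at most `4 n² ε B`, since `V s` is the backup at `α s`; dividing by `1 - (1 +
  -- γ) / 2` bounds the distance to the fixed point.
  obtain ⟨W, hW, hVW⟩ : ∃ W, F W = W ∧ dist V W ≤ 8 * n ^ 2 * ε * B / (1 - M.γ) := by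
    refine ⟨hF.fixedPoint, hF.fixedPoint_isFixedPt, (hF.dist_fixedPoint_le V).trans ?_⟩
    have h4 : dist V (F V) ≤ 4 * n ^ 2 * ε * B := by
      refine (dist_pi_le_iff (by positivity)).mpr fun s => ?_
      rw [dist_comm, Real.dist_eq]
      simpa only [hα] using hproj s _ B (hB s)
    have h5 : (1 : ℝ) - ((1 + M.γ) / 2) = (1 - M.γ) / 2 := by ring
    change dist V (F V) / (1 - (1 + M.γ) / 2) ≤ _
    rw [h5, div_le_div_iff₀ (by linarith) hγ]
    nlinarith
  refine ⟨W, fun s => congrFun hW s, fun s i c hc => ?_⟩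
  have h4 : ∀ c, |condAvg (b s) (M.backup V s) i c - condAvg (b s) (M.backup W s) i c| ≤
      dist V W := by
    intro c
    rw [condAvg, condAvg, ← prodAvg_sub]
    refine abs_prodAvg_le (hb0 s) (hb1 s) fun a => (M.abs_backup_sub_le V W s _).trans ?_
    exact mul_le_of_le_one_left dist_nonneg M.γ_lt_one.le
  have h5 : ∀ c, |condAvg (b s) (M.backup V s) i c -
      M.backup V s (Function.update (α s) i c)| ≤ 2 * (n * ε) * B :=
    fun c => abs_condAvg_sub_le (hb0 s) (hb1 s) (hB s) (hbp s) i c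
  have h6 := hΔ s (Function.update (α s) i c) fun h => hc (by simpa using congrFun h i)
  have h7 := h5 (α s i)
  rw [Function.update_eq_self, hα] at h7
  -- Each of the two compared averages is off by `dist V W` for replacing `W` by `V`, and by `2 n ε
  -- B` for replacing the other agents' noise by `α s`.
  have h8 : 2 * (8 * n ^ 2 * ε * B / (1 - M.γ)) + 4 * (n * ε * B) < Δ := by
    have : ε * (16 * (n : ℝ) ^ 2 * B / (1 - M.γ) + 4 * n * B + 1) =
      2 * (8 * n ^ 2 * ε * B / (1 - M.γ)) + 4 * (n * ε * B) + ε := by ring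
    linarith
  change condAvg (b s) _ i c < condAvg (b s) _ i (α s i)
  have h9 := abs_le.mp (h4 c)
  have h10 := abs_le.mp (h4 (α s i))
  have h11 := abs_le.mp (h5 c)
  have h12 := abs_le.mp h7
  linarith

/-! ### Least squares over the factorized class -/

/-- If the residual of `Q` is orthogonal to the factorized class at each occurring observation,
then `Q` minimizes the loss, and all minimizers agree with `Q` on the support of the data. -/
lemma bellmanLVF_of_orthogonal [Fintype A] (M : DecROMDP n S X A) {d : S → ℝ}
    {β : BehaviorPolicy n X A} (hd : ∀ s, 0 < d s) (hβ : ∀ i x a, 0 < β i x a) {R Q : IndivQ n X A}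
    (horth : ∀ s x, 0 < M.jointEmit s x → ∀ g : IndivQ n X A,
      ∑ a, (∏ i, β i (x i) (a i)) * (Qtot g x a * (M.target R s a - Qtot Q x a)) = 0) :
    Q ∈ M.bellmanLVF d β R ∧ ∀ Q' ∈ M.bellmanLVF d β R, ∀ s x, 0 < M.jointEmit s x →
      ∀ a, Qtot Q' x a = Qtot Q x a := by
  have hp : ∀ s x a, 0 ≤ M.dataProb d β s x a := fun s x a =>
    mul_nonneg (mul_nonneg (hd s).le (M.jointEmit_nonneg s x))
      (Finset.prod_nonneg fun i _ => (hβ i _ _).le)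
  -- Pythagoras: the cross term vanishes by orthogonality to `Q' - Q`. The extra square yields both
  -- minimality and uniqueness on the support.
  have hpyth : ∀ Q', M.loss d β R Q' = M.loss d β R Q +
      ∑ s, ∑ x, ∑ a, M.dataProb d β s x a * (Qtot Q' x a - Qtot Q x a) ^ 2 := by
    intro Q'
    have hcross : ∑ s, ∑ x, ∑ a, M.dataProb d β s x a *
        (2 * (Qtot Q' x a - Qtot Q x a) * (M.target R s a - Qtot Q x a)) = 0 := by
      refine Finset.sum_eq_zero fun s _ => Finset.sum_eq_zero fun x _ => ?_
      rcases (M.jointEmit_nonneg s x).eq_or_lt with h | h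
      · simp [dataProb, ← h]
      · have h1 := horth s x h (fun i x a => Q' i x a - Q i x a)
        rw [← mul_zero (d s * M.jointEmit s x * 2), ← h1, Finset.mul_sum]
        refine Finset.sum_congr rfl fun a _ => ?_
        simp only [Qtot, Finset.sum_sub_distrib, dataProb]
        ring
    rw [← sub_zero (M.loss d β R Q'), ← neg_zero, ← hcross]
    simp only [loss, ← Finset.sum_add_distrib, ← Finset.sum_neg_distrib, ← Finset.sum_sub_distrib]
    refine Finset.sum_congr rfl fun s _ => Finset.sum_congr rfl fun x _ =>
      Finset.sum_congr rfl fun a _ => ?_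
    ring
  have hnn : ∀ Q' : IndivQ n X A, ∀ s x a,
      0 ≤ M.dataProb d β s x a * (Qtot Q' x a - Qtot Q x a) ^ 2 :=
    fun Q' s x a => mul_nonneg (hp s x a) (sq_nonneg _)
  refine ⟨fun Q' => ?_, fun Q' hQ' s x hx a => ?_⟩
  · rw [hpyth Q']
    exact le_add_of_nonneg_right (Finset.sum_nonneg fun s _ => Finset.sum_nonneg fun x _ =>
      Finset.sum_nonneg fun a _ => hnn Q' s x a)
  · have h1 := hQ' Q
    rw [hpyth Q'] at h1
    have h2 : M.dataProb d β s x a * (Qtot Q' x a - Qtot Q x a) ^ 2 ≤ 0 := by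
      refine le_trans ?_ (show _ ≤ (0 : ℝ) by linarith : ∑ s, ∑ x, ∑ a,
        M.dataProb d β s x a * (Qtot Q' x a - Qtot Q x a) ^ 2 ≤ 0)
      refine le_trans ?_ (Finset.single_le_sum (fun s _ => Finset.sum_nonneg fun x _ =>
        Finset.sum_nonneg fun a _ => hnn Q' s x a) (Finset.mem_univ s))
      refine le_trans ?_ (Finset.single_le_sum (fun x _ =>
        Finset.sum_nonneg fun a _ => hnn Q' s x a) (Finset.mem_univ x))
      exact Finset.single_le_sum (fun a _ => hnn Q' s x a) (Finset.mem_univ a)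
    have h3 : 0 < M.dataProb d β s x a :=
      mul_pos (mul_pos (hd s) hx) (Finset.prod_pos fun i _ => hβ i _ _)
    have h4 : (Qtot Q' x a - Qtot Q x a) ^ 2 = 0 :=
      le_antisymm (nonpos_of_mul_nonpos_right h2 h3) (sq_nonneg _)
    exact sub_eq_zero.mp (pow_eq_zero_iff two_ne_zero |>.mp h4)

/-- Individual values with prescribed values `q s i` at the observations of state `s`, and greedy
with respect to `π` at the observations that do not occur. -/
lemma exists_indivQ_of_state [DecidableEq A] (M : DecROMDP n S X A) (q : S → Fin n → A → ℝ)
    (π : JointPolicy n X A) :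
    ∃ Q : IndivQ n X A, (∀ i s x, 0 < M.emit i s x → Q i x = q s i) ∧
      ∀ i x, ¬ M.Observable i x → ∀ a, a ≠ π i x → Q i x a < Q i x (π i x) := by
  classical
  refine ⟨fun i x => if h : M.Observable i x then q h.choose i
    else fun a => if a = π i x then 1 else 0, fun i s x hx => ?_, fun i x hx a ha => ?_⟩
  · have h : M.Observable i x := ⟨s, hx⟩
    simp only [dif_pos h, M.eq_of_emit_pos h.choose_spec hx]
  · simp [dif_neg hx, ha]

end DecROMDP

/-! ### Closing the loop -/

lemma Vtot_eq_Qtot {n : ℕ} {X A : Type*} [Finite A] [Nonempty A] {Q : IndivQ n X A} {x : Fin n → X}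
    {a : Fin n → A}
    (h : ∀ i c, Q i (x i) c ≤ Q i (x i) (a i)) : Vtot Q x = Qtot Q x a :=
  le_antisymm (ciSup_le fun a' => Finset.sum_le_sum fun i _ => h i (a' i))
    (le_ciSup (Finite.bddAbove_range fun a => Qtot Q x a) a)

/-- A strict maximizer leaves nothing to the tie-breaking rule. -/
lemma epsGreedy_eq_noisyWeights {n : ℕ} {X A : Type*} [Fintype A] [DecidableEq A]
    {argmax : (A → ℝ) → A} (hmax : IsArgmax argmax) (ε : ℝ) {Q : IndivQ n X A}
    {π : JointPolicy n X A} {i : Fin n} {x : X} (h : ∀ a, a ≠ π i x → Q i x a < Q i x (π i x)) :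
    epsGreedy argmax ε Q i x = noisyWeights ε (fun j => π j x) i := by
  have : argmax (Q i x) = π i x := by
    by_contra hne
    exact (h _ hne).not_ge (hmax _ _)
  funext a
  simp only [epsGreedy, noisyWeights, this]

theorem theorem2 {n : ℕ} {S X A : Type*} [Fintype S] [Fintype X] [Fintype A] [Nonempty A]
    [DecidableEq A] (M : DecROMDP n S X A) (πstar : JointPolicy n X A)
    (hπ : M.IsUniqueOptimal πstar) :
    ∃ ε₀ : ℝ, 0 < ε₀ ∧ ∀ ε : ℝ, 0 < ε → ε < ε₀ →
      ∀ argmax : (A → ℝ) → A, IsArgmax argmax →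
        ∀ ρ : BehaviorPolicy n X A → S → ℝ, CoversStates ρ →
          ∃ Q : IndivQ n X A,
            M.IsFixedPointLVF argmax ρ ε Q ∧ M.Expresses Q πstar := by
  -- Without agents `Qtot` is an empty sum and all claims are trivial; below, `n` is a divisor.
  rcases Nat.eq_zero_or_pos n with rfl | hn
  · refine ⟨1, one_pos, fun ε _ _ argmax _ ρ _ => ⟨fun i => i.elim0, ⟨fun Q' => ?_, ?_⟩,
      fun i => i.elim0⟩⟩
    · simp [DecROMDP.loss, Qtot]
    · intro Q' _ s x _ a
      simp [Qtot]
  have : NeZero n := ⟨hn.ne'⟩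
  have hn0 : (n : ℝ) ≠ 0 := by exact_mod_cast hn.ne'
  obtain ⟨V, α, hα, hgap, hstar⟩ := hπ.exists_greedy
  obtain ⟨ε₀, hε₀, hε₀1, hfix⟩ := M.exists_factored_fixedPoint hα hgap
  refine ⟨ε₀, hε₀, fun ε h0 hε argmax hmax ρ hρ => ?_⟩
  have hε1 : ε ≤ 1 := (hε.trans_le hε₀1).le
  obtain ⟨W, hW, hlt⟩ := hfix ε h0 hε
  -- The constant `(n - 1) * prodAvg` of the projection is shared equally by the agents, which does
  -- not affect their greedy actions. Being greedy for `πstar` off the occurring observations too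
  -- makes `hbeta` hold without exceptions.
  obtain ⟨Q, hQ, hQ'⟩ := M.exists_indivQ_of_state (fun s i c =>
    condAvg (noisyWeights ε (α s)) (M.backup W s) i c -
      ((n : ℝ) - 1) / n * prodAvg (noisyWeights ε (α s)) (M.backup W s)) πstar
  have hexp : ∀ i x a, a ≠ πstar i x → Q i x a < Q i x (πstar i x) := by
    intro i x a ha
    by_cases hx : M.Observable i x
    · obtain ⟨s, hs⟩ := hx
      rw [hQ i s x hs]
      rw [hstar i s x hs] at ha ⊢
      exact sub_lt_sub_right (hlt s i a ha) _
    · exact hQ' i x hx a ha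
  have hbeta : ∀ i x, epsGreedy argmax ε Q i x = noisyWeights ε (fun j => πstar j x) i :=
    fun i x => epsGreedy_eq_noisyWeights hmax ε (hexp i x)
  have hbpos : ∀ i x a, 0 < epsGreedy argmax ε Q i x a := fun i x a => by
    rw [hbeta]
    exact noisyWeights_pos h0 hε1 _ _ _
  have hcov := hρ (epsGreedy argmax ε Q) ⟨hbpos, fun i x => by
    rw [hbeta]
    exact sum_noisyWeights _ _⟩
  have hemit := fun s x (hx : 0 < M.jointEmit s x) i => M.emit_pos_of_jointEmit_pos hx i
  have hQtot : ∀ s x, 0 < M.jointEmit s x → ∀ a, Qtot Q x a =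
      additiveProj (noisyWeights ε (α s)) (M.backup W s) a := by
    intro s x hx a
    simp only [Qtot, hQ _ s _ (hemit s x hx _), Finset.sum_sub_distrib, additiveProj,
      Finset.sum_const, Finset.card_univ, Fintype.card_fin, nsmul_eq_mul]
    field_simp
  -- Self-consistency: the joint maximum is attained at `α s`, where the projection equals `W s` by
  -- the fixed-point equation. Hence the targets of `Q` are the backups of `W`.
  have hVtot : ∀ s x, 0 < M.jointEmit s x → Vtot Q x = W s := by
    intro s x hx
    rw [Vtot_eq_Qtot (a := α s), hQtot s x hx, hW]
    intro i c
    rw [← hstar i s _ (hemit s x hx i)]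
    rcases eq_or_ne c (πstar i (x i)) with rfl | hc
    · exact le_rfl
    · exact (hexp i _ c hc).le
  have htarget : ∀ s a, M.target Q s a = M.backup W s a := fun s a => by
    simp only [DecROMDP.target, DecROMDP.backup, M.sum_jointEmit_mul_eq (hVtot _)]
  refine ⟨Q, M.bellmanLVF_of_orthogonal hcov.1 hbpos fun s x hx g => ?_, fun i x _ => hexp i x⟩
  have hw : ∀ i, epsGreedy argmax ε Q i (x i) = noisyWeights ε (α s) i := fun i => by
    rw [hbeta]
    funext c
    simp only [noisyWeights, hstar i s _ (hemit s x hx i)]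
  simp only [hw, htarget, hQtot s x hx]
  -- `Qtot g` is a sum of functions of one coordinate, and the residual is orthogonal to each.
  have h1 := prodAvg_sum Finset.univ (noisyWeights ε (α s)) fun (i : Fin n) a =>
    g i (x i) (a i) * (M.backup W s a - additiveProj (noisyWeights ε (α s)) (M.backup W s) a)
  simp only [← Finset.sum_mul] at h1
  refine h1.trans (Finset.sum_eq_zero fun i _ => ?_)
  exact prodAvg_mul_residual (fun j => sum_noisyWeights _ j) i (g i (x i)) (M.backup W s)
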